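/- \textbf{Theorem (pullback).} Let $K$ be a field, let $S$ be a $K$-algebra which is a normal (i.e. integrally closed) domain, and let $Y=\operatorname{Spec} S$. Let $G$ be a finite group acting faithfully on $S$ by $K$-algebra automorphisms, through $\beta\colon G\to\operatorname{Aut}_K(S)$, and let $R=S^G$ and $X=Y/G=\operatorname{Spec} R$. Let $\rho\colon G\to \operatorname{GL}_m(K)$ be a linear representation, let $G$ act on $Y\times\mathbb A^m=\operatorname{Spec} S[W_1,\dots,W_m]$ by $\beta\times\rho$, that is $g(y,v)=(gy,\rho(g)v)$, and let $Z_\rho=(Y\times\mathbb A^m)/(\beta\times\rho)=\operatorname{Spec}\bigl(S[W_1,\dots,W_m]^{\beta\times\rho}\bigr)\to X$ be the quotient scheme. Let $G$ act on $Y\times_X Z_\rho$ through the first component. Let \[ \pi_\rho\colon Y\times\mathbb A^m\longrightarrow Y\times_X Z_\rho,\qquad (y,v)\mapsto (y,[(y,v)]), \] be the natural morphism given by the projection to $Y$ and the quotient morphism to $Z_\rho$. Then the following hold. \begin{enumerate} \item $\pi_\rho$ is $G$-equivariant, finite and surjective. \item $\pi_\rho$ is the normalization of $Y\times_X Z_\rho$,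 i.e. it identifies $S[W_1,\dots,W_m]$ with the integral closure of the reduction of $S\otimes_R S[W_1,\dots,W_m]^{\beta\times\rho}$ in its total ring of fractions. \item Call the action free on a $G$-invariant open subset $V\subseteq Y$ if the morphism $G\times V\to V\times_K V$, $(g,y)\mapsto (gy,y)$, is a closed embedding, and let $V_0\subseteq Y$ be the union of all such $V$. Then $\pi_\rho$ is an isomorphism over $V_0$, that is, over the preimage of $V_0$ in $Y\times_X Z_\rho$. \item The linear action on $Y\times\mathbb A^m$ can be recovered from $Z_\rho\to X$ in the following sense. \begin{enumerate} \item For each $g\in G$, the action of $g$ on $Y\times\mathbb A^m$ is the only morphism $\psi\colon Y\times\mathbb A^m\to Y\times\mathbb A^m$ lifting the action of $g$ on $Y\times_X Z_\rho$, i.e. with $\pi_\rho\circ\psi=g\circ\pi_\rho$. \item Let $\rho'\colon G\to\operatorname{GL}_{m'}(K)$ be another linear representation and let $\theta\colon Z_\rho\to Z_{\rho'}$ be an isomorphism over $X$. Then there is a unique morphism $\Theta\colon Y\times\mathbb A^m\to Y\times\mathbb A^{m'}$ with $\pi_{\rho'}\circ\Theta=(\operatorname{id}_Y\times_X\theta)\circ\pi_\rho$,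 and $\Theta$ is a $G$-equivariant isomorphism. Moreover, there is a $G$-equivariant isomorphism $Y\times\mathbb A^m\to Y\times\mathbb A^{m'}$ that is linear over $Y$, i.e. of the form $(y,v)\mapsto(y,M(y)v)$ with a matrix $M\in \operatorname{Mat}_{m'\times m}(S)$. \end{enumerate} \end{enumerate} -/

import Mathlib

universe u v

open CategoryTheory CategoryTheory.Limits AlgebraicGeometry

noncomputable section

namespace PullbackNormalization

section Actions

variable {K : Type u} {S : Type u} {G : Type v} [Field K] [CommRing S] [Algebra K S] [Group G]

/-- The invariant ring `A^G` of a group action `α` on a `K`-algebra `A` by `K`-algebra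
automorphisms. -/
def invariants {A : Type u} [CommRing A] [Algebra K A] (α : G →* (A ≃ₐ[K] A)) :
    Subalgebra K A where
  carrier := {a | ∀ g, α g a = a}
  mul_mem' ha hb g := by rw [map_mul, ha g, hb g]
  add_mem' ha hb g := by rw [map_add, ha g, hb g]
  algebraMap_mem' r g := (α g).commutes r

/-- The geometric action (from the left) on `Spec A`: the element `g` acts through the morphism
whose comorphism is `f ↦ g⁻¹ • f`, so that `(g • f)(y) = f (g⁻¹ y)`. -/
def specAct {A : Type u} [CommRing A] [Algebra K A] (α : G →* (A ≃ₐ[K] A)) (g : G) :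
    Spec (.of A) ⟶ Spec (.of A) :=
  Spec.map (CommRingCat.ofHom (α g⁻¹ : A ≃ₐ[K] A).toAlgHom.toRingHom)

/-- The quotient scheme `(Spec A) / G = Spec (A^G)`. -/
abbrev quotientScheme {A : Type u} [CommRing A] [Algebra K A] (α : G →* (A ≃ₐ[K] A)) : Scheme.{u} :=
  Spec (.of (invariants α))

/-- The quotient morphism `Spec A ⟶ (Spec A) / G`. -/
def quotientMap {A : Type u} [CommRing A] [Algebra K A] (α : G →* (A ≃ₐ[K] A)) :
    Spec (.of A) ⟶ quotientScheme α :=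
  Spec.map (CommRingCat.ofHom (invariants α).val.toRingHom)

variable {m : ℕ}

/-- The endomorphism of `S[W₁, …, W_m]` belonging to `g`. On coefficients it is `β g`. On the
coordinate functions it is `W_j ↦ ∑ k, (ρ g⁻¹)_{jk} W_k`, that is, `(g • W_j)(v) = W_j (ρ(g)⁻¹ v)`. -/
def productActionHom (β : G →* (S ≃ₐ[K] S)) (ρ : G →* Matrix.GeneralLinearGroup (Fin m) K)
    (g : G) : MvPolynomial (Fin m) S →ₐ[K] MvPolynomial (Fin m) S where
  toRingHom := MvPolynomial.eval₂Hom (MvPolynomial.C.comp (β g).toAlgHom.toRingHom)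
    (fun j => ∑ k, MvPolynomial.C (algebraMap K S ((ρ g⁻¹).val j k)) * MvPolynomial.X k)
  commutes' r := by
    simp [MvPolynomial.algebraMap_eq, IsScalarTower.algebraMap_apply K S (MvPolynomial (Fin m) S)]

@[simp] lemma productActionHom_C (β : G →* (S ≃ₐ[K] S))
    (ρ : G →* Matrix.GeneralLinearGroup (Fin m) K) (g : G) (s : S) :
    productActionHom β ρ g (MvPolynomial.C s) = MvPolynomial.C (β g s) := by
  simp [productActionHom]

@[simp] lemma productActionHom_X (β : G →* (S ≃ₐ[K] S))
    (ρ : G →* Matrix.GeneralLinearGroup (Fin m) K) (g : G) (j : Fin m) :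
    productActionHom β ρ g (MvPolynomial.X j) =
      ∑ k, MvPolynomial.C (algebraMap K S ((ρ g⁻¹).val j k)) * MvPolynomial.X k := by
  simp [productActionHom]

lemma productActionHom_comp (β : G →* (S ≃ₐ[K] S))
    (ρ : G →* Matrix.GeneralLinearGroup (Fin m) K) (g h : G) (f : MvPolynomial (Fin m) S) :
    productActionHom β ρ g (productActionHom β ρ h f) = productActionHom β ρ (g * h) f := by
  induction f using MvPolynomial.induction_on with
  | C s => simp
  | add p q hp hq => rw [map_add, map_add, map_add, hp, hq]
  | mul_X p j hp =>
    rw [map_mul, map_mul, map_mul, hp]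
    refine congrArg (productActionHom β ρ (g * h) p * ·) ?_
    have hmul : ∀ l, (ρ (g * h)⁻¹).val j l = ∑ k, (ρ h⁻¹).val j k * (ρ g⁻¹).val k l := by
      intro l
      rw [mul_inv_rev, map_mul]
      exact Matrix.mul_apply
    rw [productActionHom_X, productActionHom_X, map_sum]
    simp_rw [hmul, map_mul, productActionHom_C, productActionHom_X, AlgEquiv.commutes, map_sum,
      Finset.mul_sum, Finset.sum_mul, map_mul]
    rw [Finset.sum_comm]
    simp_rw [mul_assoc]

lemma productActionHom_one (β : G →* (S ≃ₐ[K] S))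
    (ρ : G →* Matrix.GeneralLinearGroup (Fin m) K) (f : MvPolynomial (Fin m) S) :
    productActionHom β ρ 1 f = f := by
  induction f using MvPolynomial.induction_on with
  | C s => simp
  | add p q hp hq => rw [map_add, hp, hq]
  | mul_X p j hp =>
    rw [map_mul, hp]
    refine congrArg (p * ·) ?_
    simp [Matrix.one_apply, apply_ite]

/-- The product action `β × ρ` of `G` on `S[W₁, …, W_m]`. -/
def productAction (β : G →* (S ≃ₐ[K] S)) (ρ : G →* Matrix.GeneralLinearGroup (Fin m) K) :
    G →* (MvPolynomial (Fin m) S ≃ₐ[K] MvPolynomial (Fin m) S) where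
  toFun g := AlgEquiv.ofAlgHom (productActionHom β ρ g) (productActionHom β ρ g⁻¹)
    (AlgHom.ext fun f => by simp [productActionHom_comp, productActionHom_one])
    (AlgHom.ext fun f => by simp [productActionHom_comp, productActionHom_one])
  map_one' := by
    ext1 f
    exact productActionHom_one β ρ f
  map_mul' g h := by
    ext1 f
    exact (productActionHom_comp β ρ g h f).symm

/-- The trivial vector bundle `Y × 𝔸^m = Spec S[W₁, …, W_m]` over `Y = Spec S`. -/
abbrev bundle (S : Type u) [CommRing S] (m : ℕ) : Scheme.{u} :=
  Spec (.of (MvPolynomial (Fin m) S))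

/-- The projection `Y × 𝔸^m ⟶ Y`. -/
def bundleProj (S : Type u) [CommRing S] (m : ℕ) : bundle S m ⟶ Spec (.of S) :=
  Spec.map (CommRingCat.ofHom MvPolynomial.C)

/-- The quotient scheme `Z_ρ = (Y × 𝔸^m) / (β × ρ)`. -/
abbrev Zrho (β : G →* (S ≃ₐ[K] S)) (ρ : G →* Matrix.GeneralLinearGroup (Fin m) K) : Scheme.{u} :=
  quotientScheme (productAction β ρ)

/-- The inclusion `S^G → S[W₁, …, W_m]^{β × ρ}` as constant polynomials. -/
def invariantsC (β : G →* (S ≃ₐ[K] S)) (ρ : G →* Matrix.GeneralLinearGroup (Fin m) K) :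
    invariants β →+* invariants (productAction β ρ) :=
  (MvPolynomial.C.comp (invariants β).val.toRingHom).codRestrict (invariants (productAction β ρ))
    (fun r g => (productActionHom_C β ρ g r).trans (congrArg MvPolynomial.C (r.2 g)))

/-- The structure morphism `Z_ρ ⟶ X = Y / G`. -/
def ZrhoToX (β : G →* (S ≃ₐ[K] S)) (ρ : G →* Matrix.GeneralLinearGroup (Fin m) K) :
    Zrho β ρ ⟶ quotientScheme β :=
  Spec.map (CommRingCat.ofHom (invariantsC β ρ))

lemma bundleProj_quotientMap (β : G →* (S ≃ₐ[K] S))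
    (ρ : G →* Matrix.GeneralLinearGroup (Fin m) K) :
    bundleProj S m ≫ quotientMap β = quotientMap (productAction β ρ) ≫ ZrhoToX β ρ := by
  simp only [bundleProj, quotientMap, ZrhoToX, ← Spec.map_comp, ← CommRingCat.ofHom_comp]
  rfl

lemma specAct_quotientMap {A : Type u} [CommRing A] [Algebra K A] (α : G →* (A ≃ₐ[K] A)) (g : G) :
    specAct α g ≫ quotientMap α = quotientMap α := by
  simp only [specAct, quotientMap, ← Spec.map_comp, ← CommRingCat.ofHom_comp]
  congr 2
  ext a
  exact a.2 g⁻¹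

/-- The pull-back `Y ×_X Z_ρ`. -/
abbrev pullbackScheme (β : G →* (S ≃ₐ[K] S)) (ρ : G →* Matrix.GeneralLinearGroup (Fin m) K) :
    Scheme.{u} :=
  pullback (quotientMap β) (ZrhoToX β ρ)

/-- The action of `G` on `Y ×_X Z_ρ` through the first component. -/
def pullbackAct (β : G →* (S ≃ₐ[K] S)) (ρ : G →* Matrix.GeneralLinearGroup (Fin m) K) (g : G) :
    pullbackScheme β ρ ⟶ pullbackScheme β ρ :=
  pullback.lift (pullback.fst _ _ ≫ specAct β g) (pullback.snd _ _)
    (by rw [Category.assoc, specAct_quotientMap, pullback.condition])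

/-- The natural morphism `Y × 𝔸^m ⟶ Y ×_X Z_ρ`, `(y, v) ↦ (y, [(y, v)])`. -/
def toPullback (β : G →* (S ≃ₐ[K] S)) (ρ : G →* Matrix.GeneralLinearGroup (Fin m) K) :
    bundle S m ⟶ pullbackScheme β ρ :=
  pullback.lift (bundleProj S m) (quotientMap (productAction β ρ)) (bundleProj_quotientMap β ρ)

/-- The morphism `Y ×_X Z_ρ ⟶ Y ×_X Z_ρ'` induced by a morphism `θ : Z_ρ ⟶ Z_ρ'` over `X`. -/
def pullbackMap {m' : ℕ} (β : G →* (S ≃ₐ[K] S))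
    (ρ : G →* Matrix.GeneralLinearGroup (Fin m) K) (ρ' : G →* Matrix.GeneralLinearGroup (Fin m') K)
    (θ : Zrho β ρ ⟶ Zrho β ρ') (hθ : θ ≫ ZrhoToX β ρ' = ZrhoToX β ρ) :
    pullbackScheme β ρ ⟶ pullbackScheme β ρ' :=
  pullback.lift (pullback.fst _ _) (pullback.snd _ _ ≫ θ)
    (by rw [Category.assoc, hθ, pullback.condition])

/-- The morphism `Y × 𝔸^m ⟶ Y × 𝔸^{m'}`, `(y, v) ↦ (y, M(y) v)` of trivial vector bundles over `Y`
given by a matrix `M` with entries in `S`. -/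
def linearMorphism {m' : ℕ} (M : Matrix (Fin m') (Fin m) S) : bundle S m ⟶ bundle S m' :=
  Spec.map (CommRingCat.ofHom
    (MvPolynomial.aeval (R := S) fun i : Fin m' =>
      ∑ j, MvPolynomial.C (M i j) * (MvPolynomial.X j : MvPolynomial (Fin m) S)).toRingHom)

end Actions

section Free

variable {K : Type u} {S : Type u} {G : Type v} [Field K] [CommRing S] [Algebra K S] [Group G]

/-- The structure morphism `Spec S ⟶ Spec K`. -/
def structureMap (K S : Type u) [Field K] [CommRing S] [Algebra K S] :
    Spec (.of S) ⟶ Spec (.of K) :=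
  Spec.map (CommRingCat.ofHom (algebraMap K S))

lemma specAct_structureMap (β : G →* (S ≃ₐ[K] S)) (g : G) :
    specAct β g ≫ structureMap K S = structureMap K S := by
  simp only [specAct, structureMap, ← Spec.map_comp, ← CommRingCat.ofHom_comp]
  congr 2
  ext a
  exact (β g⁻¹).commutes a

/-- An open subset of `Spec S` is invariant under the action. -/
def IsInvariantOpen (β : G →* (S ≃ₐ[K] S)) (V : (Spec (.of S)).Opens) : Prop :=
  ∀ g, V ≤ specAct β g ⁻¹ᵁ V

variable [Finite G]

/-- The morphism `G × V ⟶ V ×_K V`, `(g, y) ↦ (g y, y)`, where `G × V` is the disjoint union of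
copies of `V` indexed by `G`. -/
def actionGraph (β : G →* (S ≃ₐ[K] S)) (V : (Spec (.of S)).Opens) (hV : IsInvariantOpen β V) :
    (∐ fun _ : G => (V : Scheme.{u})) ⟶ pullback (V.ι ≫ structureMap K S) (V.ι ≫ structureMap K S) :=
  Sigma.desc fun g => pullback.lift ((specAct β g).resLE V V (hV g)) (𝟙 _)
    (by rw [Scheme.Hom.resLE_comp_ι_assoc, specAct_structureMap, Category.id_comp])

/-- The open subset `V` is invariant and the action of `G` on `V` is free, i.e.
`G × V ⟶ V ×_K V`, `(g, y) ↦ (g y, y)` is a closed embedding. -/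
def IsFreeOn (β : G →* (S ≃ₐ[K] S)) (V : (Spec (.of S)).Opens) : Prop :=
  ∃ hV : IsInvariantOpen β V, IsClosedImmersion (actionGraph β V hV)

/-- The free locus in `Spec S`: the union of all invariant open subsets on which the action is
free. -/
def freeLocus (β : G →* (S ≃ₐ[K] S)) : (Spec (.of S)).Opens :=
  sSup {V | IsFreeOn β V}

end Free

section Normalization

/-- The ring homomorphism `φ : A → B` is the normalization of `A`: it is isomorphic under `A` to the
integral closure of the reduction `A / nilradical A` in its total ring of fractions. -/
def IsRingNormalization {A B : Type*} [CommRing A] [CommRing B] (φ : A →+* B) : Prop :=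
  ∃ e : B ≃+* integralClosure (A ⧸ nilradical A) (FractionRing (A ⧸ nilradical A)),
    ∀ a, e (φ a) = algebraMap (A ⧸ nilradical A) _ (Ideal.Quotient.mk (nilradical A) a)

/-- The morphism `f : N ⟶ W` of affine schemes is the normalization of (the reduction of) `W`. -/
def IsNormalization {N W : Scheme.{u}} [IsAffine N] [IsAffine W] (f : N ⟶ W) : Prop :=
  IsRingNormalization f.appTop.hom

end Normalization

end PullbackNormalization

end

open PullbackNormalization

/-! Write `B = S[W₁, …, W_m]`. As `Y ×_X Z_ρ` is the spectrum of `S ⊗ B^G` over `S^G`, the geometry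
is governed by the multiplication `μ : S ⊗ B^G → B` (`mulInvariants`). It is integral because `B` is
integral over `B^G`.

The kernel of `μ` is nil (`isNilpotent_of_mulInvariants_eq_zero`): an element `a` of the kernel
satisfies a polynomial of degree `|G|` whose coefficients come from `B^G` and can be computed in
`B`, where the polynomial is `X ^ |G|`.

Moreover `μ` is invertible up to a denominator. Suppose `∑ xᵢ * g yᵢ` equals `d` for `g = 1` and
vanishes for `g ≠ 1`. Then `L b = ∑ xᵢ ⊗ Tr (yᵢ b)` satisfies `L ∘ μ = d` and `μ ∘ L = d`
(`IsGaloisDenominator.exists_section`), as in Galois descent. Products of elements `y - g y` are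
such denominators. By faithfulness one of them is nonzero, so `μ` is birational and the normal
domain `B` is the normalization. At a point of the free locus one of them is a unit, so `μ` is an
isomorphism there.

Lifts are unique because `d * b` is in the image of `μ` and `d` cancels in a domain; they exist
because normalizations are unique. Equivariance follows from uniqueness. Finally, `Θ` is replaced by
its Jacobian along the zero section. This is invertible by the chain rule, and equivariant because
both group actions are linear. -/

namespace PullbackNormalization

/-! ### Recognizing a normalization -/

section RingNormalization

/-- A ring homomorphism that is integral, has nil kernel, and is such that every element of the
target is a fraction of two elements of the image. -/
structure IsIntegralBirational {A B : Type*} [CommRing A] [CommRing B] (φ : A →+* B) : Prop where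
  isIntegral : φ.IsIntegral
  isNilpotent : ∀ a, φ a = 0 → IsNilpotent a
  exists_mul_eq : ∀ b, ∃ d a, φ d ≠ 0 ∧ φ d * b = φ a

lemma IsIntegralBirational.comp_ringEquiv {A A' B B' : Type*} [CommRing A] [CommRing A']
    [CommRing B] [CommRing B'] {φ : A →+* B} (h : IsIntegralBirational φ) (eA : A' ≃+* A)
    (eB : B ≃+* B') :
    IsIntegralBirational ((eB : B →+* B').comp (φ.comp (eA : A' →+* A))) where
  isIntegral :=
    ((RingHom.isIntegral_of_surjective _ eA.surjective).trans _ _ h.isIntegral).trans _ _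
      (RingHom.isIntegral_of_surjective _ eB.surjective)
  isNilpotent a ha := by
    have : φ (eA a) = 0 := by simpa using ha
    exact (IsNilpotent.map_iff eA.injective).mp (h.isNilpotent _ this)
  exists_mul_eq b := by
    obtain ⟨d, a, hd, hda⟩ := h.exists_mul_eq (eB.symm b)
    refine ⟨eA.symm d, eA.symm a, by simpa using hd, ?_⟩
    have := congrArg eB hda
    simpa using this

theorem IsIntegralBirational.isRingNormalization {A B : Type*} [CommRing A] [CommRing B]
    [IsDomain B] [IsIntegrallyClosed B] {φ : A →+* B} (h : IsIntegralBirational φ) :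
    IsRingNormalization φ := by
  have hker : ∀ a ∈ nilradical A, φ a = 0 := fun a ha =>
    (IsNilpotent.map (mem_nilradical.mp ha) φ).eq_zero
  let ψ : A ⧸ nilradical A →+* B := Ideal.Quotient.lift _ φ hker
  have hψ : ∀ a, ψ (Ideal.Quotient.mk _ a) = φ a := fun a => Ideal.Quotient.lift_mk _ _ _
  have hinj : Function.Injective ψ := by
    rw [injective_iff_map_eq_zero]
    intro a ha
    obtain ⟨a, rfl⟩ := Ideal.Quotient.mk_surjective a
    exact Ideal.Quotient.eq_zero_iff_mem.mpr (h.isNilpotent a ((hψ a).symm.trans ha))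
  let L := FractionRing B
  let : Algebra (A ⧸ nilradical A) B := ψ.toAlgebra
  have : IsDomain (A ⧸ nilradical A) := hinj.isDomain ψ
  have : Algebra.IsIntegral (A ⧸ nilradical A) B := ⟨fun b => by
    have := h.isIntegral b
    have e : φ = ψ.comp (Ideal.Quotient.mk _) := RingHom.ext fun a => (hψ a).symm
    rw [e] at this
    exact RingHom.IsIntegralElem.of_comp this⟩
  have hL : ∀ a, algebraMap (A ⧸ nilradical A) L a = algebraMap B L (ψ a) := fun a =>
    IsScalarTower.algebraMap_apply (A ⧸ nilradical A) B L a
  have hinjL : Function.Injective (algebraMap (A ⧸ nilradical A) L) :=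
    fun a b hab => hinj (IsFractionRing.injective B L (by rwa [hL, hL] at hab))
  have : IsFractionRing (A ⧸ nilradical A) L := by
    have : FaithfulSMul (A ⧸ nilradical A) L := (faithfulSMul_iff_algebraMap_injective _ _).mpr hinjL
    refine IsFractionRing.of_field (A ⧸ nilradical A) L fun z => ?_
    obtain ⟨x, y, hy, rfl⟩ := IsFractionRing.div_surjective (A := B) z
    obtain ⟨d, a, hd, hda⟩ := h.exists_mul_eq x
    obtain ⟨d', a', hd', hda'⟩ := h.exists_mul_eq y
    have hy0 : y ≠ 0 := nonZeroDivisors.ne_zero hy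
    have inj := IsFractionRing.injective B L
    have h0 : ∀ {b : B}, b ≠ 0 → algebraMap B L b ≠ 0 := fun hb =>
      (map_ne_zero_iff _ inj).mpr hb
    -- With `x = a / d` and `y = a' / d'`, the quotient `x / y` is `(a * d') / (a' * d)`.
    refine ⟨Ideal.Quotient.mk _ (a * d'), Ideal.Quotient.mk _ (a' * d), ?_⟩
    rw [hL, hL, hψ, hψ, map_mul φ, map_mul φ, ← hda, ← hda']
    simp only [map_mul]
    have h1 := h0 hd
    have h2 := h0 hd'
    have h3 := h0 hy0
    rw [div_eq_div_iff h3 (mul_ne_zero (mul_ne_zero h2 h3) h1)]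
    ring
  -- `B` is integral over `A / nilradical A` and integrally closed in the common fraction field `L`.
  have : IsIntegralClosure B (A ⧸ nilradical A) L := inferInstance
  let eL : L ≃ₐ[A ⧸ nilradical A] FractionRing (A ⧸ nilradical A) :=
    (FractionRing.algEquiv (A ⧸ nilradical A) L).symm
  let e : B ≃ₐ[A ⧸ nilradical A] integralClosure (A ⧸ nilradical A) L :=
    IsIntegralClosure.equiv _ B L _
  refine ⟨(e.trans (integralClosure (A ⧸ nilradical A) L |>.equivMapOfInjective eL.toAlgHom eL.injective |>.trans
    (Subalgebra.equivOfEq _ _ (integralClosure_map_algEquiv eL)))).toRingEquiv, fun a => ?_⟩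
  rw [← hψ]
  exact AlgEquiv.commutes _ _

/-- Two normalizations of the same ring are isomorphic. -/
lemma IsRingNormalization.exists_ringEquiv {A B C : Type*} [CommRing A] [CommRing B] [CommRing C]
    {φ : A →+* B} {ψ : A →+* C} (hφ : IsRingNormalization φ) (hψ : IsRingNormalization ψ) :
    ∃ e : B ≃+* C, (e : B →+* C).comp φ = ψ := by
  obtain ⟨e, he⟩ := hφ
  obtain ⟨e', he'⟩ := hψ
  refine ⟨e.trans e'.symm, RingHom.ext fun a => ?_⟩
  simp [he, ← he']

end RingNormalization

/-- Polynomial rings in finitely many variables over integrally closed domains are integrally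
closed. -/
theorem isIntegrallyClosed_mvPolynomial_fin (S : Type*) [CommRing S] [IsDomain S]
    [IsIntegrallyClosed S] (m : ℕ) : IsIntegrallyClosed (MvPolynomial (Fin m) S) := by
  induction m with
  | zero => exact IsIntegrallyClosed.of_equiv (MvPolynomial.isEmptyRingEquiv S (Fin 0)).symm
  | succ m ih => exact IsIntegrallyClosed.of_equiv (MvPolynomial.finSuccEquiv S m).symm.toRingEquiv

/-! ### Jacobians of invertible polynomial maps -/

section Jacobian

open MvPolynomial

variable {S : Type*} [CommRing S] {m m' : ℕ}

/-- The chain rule for a derivation composed with a substitution of polynomials. -/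
lemma pderiv_aeval_eq_sum {σ τ : Type*} [Fintype σ] (f : σ → MvPolynomial τ S) (k : τ)
    (p : MvPolynomial σ S) :
    pderiv k (aeval f p) = ∑ i, aeval f (pderiv i p) * pderiv k (f i) := by
  classical
  induction p using MvPolynomial.induction_on with
  | C a => simp
  | add p q hp hq => simp only [map_add, hp, hq, add_mul, Finset.sum_add_distrib]
  | mul_X p j hp =>
    simp only [map_mul, aeval_X, Derivation.leibniz, hp, map_add, smul_eq_mul, add_mul,
      Finset.sum_add_distrib, pderiv_X, Finset.mul_sum]
    refine congrArg₂ (· + ·) ?_ ?_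
    · rw [Finset.sum_eq_single j]
      · simp
      · intro i _ hij
        simp [hij]
      · simp
    · exact Finset.sum_congr rfl fun i _ => by ring

/-- The Jacobian matrix at the origin of the polynomial map with components `f i`. -/
noncomputable def linearPart (f : Fin m' → MvPolynomial (Fin m) S) : Matrix (Fin m') (Fin m) S :=
  Matrix.of fun i j => constantCoeff (pderiv j (f i))

/-- The Jacobian of a polynomial map with a polynomial inverse is invertible. -/
lemma exists_linearPart_inverse (f : Fin m' → MvPolynomial (Fin m) S)
    (h : Fin m → MvPolynomial (Fin m') S) (hf : ∀ i, aeval h (f i) = X i)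
    (hh : ∀ j, aeval f (h j) = X j) :
    ∃ N : Matrix (Fin m) (Fin m') S, linearPart f * N = 1 ∧ N * linearPart f = 1 := by
  -- The map `f` need not preserve the origin. The inverse Jacobian is therefore that of `h` at `p =
  -- f(0)`, where `h(p) = 0`.
  let p : Fin m' → S := fun i => constantCoeff (f i)
  have hp : ∀ q : MvPolynomial (Fin m') S, constantCoeff (aeval f q) = eval p q := by
    intro q
    induction q using MvPolynomial.induction_on with
    | C a => simp
    | add q r hq hr => simp only [map_add, hq, hr]
    | mul_X q i hq => simp only [map_mul, aeval_X, eval_X, hq, p]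
  have hp' : ∀ q : MvPolynomial (Fin m) S, eval p (aeval h q) = constantCoeff q := by
    intro q
    rw [← hp]
    congr 1
    induction q using MvPolynomial.induction_on with
    | C a => simp
    | add q r hq hr => simp only [map_add, hq, hr]
    | mul_X q i hq => simp only [map_mul, aeval_X, hq, hh]
  refine ⟨Matrix.of fun j k => eval p (pderiv k (h j)), ?_, ?_⟩
  · ext i k
    have := congrArg (fun q => eval p (pderiv k q)) (hf i)
    simp only [pderiv_aeval_eq_sum, map_sum, map_mul, hp'] at this
    simp only [Matrix.mul_apply, linearPart, Matrix.of_apply, this, pderiv_X, Matrix.one_apply,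
      Pi.single_apply]
    split_ifs <;> simp
  · ext j k
    have := congrArg (fun q => constantCoeff (pderiv k q)) (hh j)
    simp only [pderiv_aeval_eq_sum, map_sum, map_mul, hp] at this
    simp only [Matrix.mul_apply, linearPart, Matrix.of_apply, this, pderiv_X, Matrix.one_apply,
      Pi.single_apply]
    split_ifs <;> simp

end Jacobian

/-! ### The multiplication map from the tensor product with the invariants -/

section InvariantTensor

open scoped TensorProduct

variable {K S B : Type u} {G : Type v} [Field K] [CommRing S] [Algebra K S] [Group G]
  [CommRing B] [Algebra K B] (β : G →* (S ≃ₐ[K] S)) (α : G →* (B ≃ₐ[K] B))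

/-- A ring with a finite group action is integral over the invariants. -/
lemma isIntegral_invariants [Finite G] (b : B) : _root_.IsIntegral (invariants α) b := by
  let : MulSemiringAction G B := MulSemiringAction.compHom B α
  have : Algebra.IsInvariant (invariants α) B G := ⟨fun b hb => ⟨⟨b, hb⟩, rfl⟩⟩
  exact (Algebra.IsInvariant.isIntegral (invariants α) B G).isIntegral b

/-- The trace `∑ g, g • b` as an invariant element. -/
noncomputable def invariantTrace [Fintype G] : B →+ invariants α where
  toFun b := ⟨∑ g, α g b, fun h => by
    rw [map_sum]
    refine Fintype.sum_equiv (Equiv.mulLeft h) _ _ fun g => ?_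
    simp [map_mul]⟩
  map_zero' := by ext; simp
  map_add' a b := by ext; simp [Finset.sum_add_distrib]

lemma coe_invariantTrace [Fintype G] (b : B) : (invariantTrace α b : B) = ∑ g, α g b := rfl

/-- The homomorphism `S ⊗ S → S`, `x ⊗ y ↦ x * β g y`. -/
noncomputable def twistedMul (g : G) : S ⊗[K] S →ₐ[K] S :=
  Algebra.TensorProduct.lift (AlgHom.id K S) (β g : S ≃ₐ[K] S).toAlgHom fun _ _ => Commute.all _ _

@[simp] lemma twistedMul_tmul (g : G) (x y : S) : twistedMul β g (x ⊗ₜ y) = x * β g y := by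
  simp [twistedMul]

/-- There are `xᵢ, yᵢ ∈ S` with `∑ xᵢ * g yᵢ = 0` for `g ≠ 1` and `∑ xᵢ * yᵢ = d`. -/
def IsGaloisDenominator (d : S) : Prop :=
  ∃ e : S ⊗[K] S, twistedMul β 1 e = d ∧ ∀ g ≠ 1, twistedMul β g e = 0

/-- Under `x ⊗ z ↦ x * h z` the factor `1 ⊗ y g - g (y g) ⊗ 1` becomes `h (y g) - g (y g)`. For `h ≠
1` the factor with `g = h` vanishes; for `h = 1` the product is the stated denominator. -/
lemma isGaloisDenominator_prod [Fintype G] [DecidableEq G] (y : G → S) :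
    IsGaloisDenominator β (∏ g ∈ Finset.univ.erase 1, (y g - β g (y g))) := by
  refine ⟨∏ g ∈ Finset.univ.erase 1, (1 ⊗ₜ y g - β g (y g) ⊗ₜ 1), by simp [map_prod], fun g hg => ?_⟩
  rw [map_prod]
  exact Finset.prod_eq_zero (Finset.mem_erase.mpr ⟨hg, Finset.mem_univ _⟩) (by simp)

lemma exists_isGaloisDenominator_ne_zero [Finite G] [IsDomain S] (hβ : Function.Injective β) :
    ∃ d ≠ 0, IsGaloisDenominator β d := by
  classical
  cases nonempty_fintype G
  have : ∀ g : G, ∃ y, g ≠ 1 → y - β g y ≠ 0 := by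
    intro g
    by_contra! h
    refine (h 0).1 (hβ (AlgEquiv.ext fun y => ?_))
    simpa using (sub_eq_zero.mp (h y).2).symm
  choose y hy using this
  exact ⟨_, Finset.prod_ne_zero_iff.mpr fun g hg => hy g (Finset.ne_of_mem_erase hg),
    isGaloisDenominator_prod β y⟩

variable [Algebra S B] [Algebra (invariants β) (invariants α)]
  [IsScalarTower (invariants β) (invariants α) B]

/-- The multiplication `S ⊗ B^G → B` over `S^G`. -/
noncomputable def mulInvariants : S ⊗[invariants β] invariants α →ₐ[S] B :=
  Algebra.TensorProduct.lift (Algebra.ofId S B)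
    (IsScalarTower.toAlgHom (invariants β) (invariants α) B) fun _ _ => Commute.all _ _

@[simp] lemma mulInvariants_tmul (s : S) (t : invariants α) :
    mulInvariants β α (s ⊗ₜ t) = algebraMap S B s * t := by
  simp [mulInvariants, Algebra.ofId_apply]

lemma isIntegral_mulInvariants [Finite G] :
    (mulInvariants β α : S ⊗[invariants β] invariants α →+* B).IsIntegral := by
  intro b
  have h : algebraMap (invariants α) B =
      (mulInvariants β α : S ⊗[invariants β] invariants α →+* B).comp
        (Algebra.TensorProduct.includeRight (R := invariants β) (A := S)).toRingHom := by
    ext t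
    simp
  have := isIntegral_invariants α b
  unfold _root_.IsIntegral at this
  rw [h] at this
  exact RingHom.IsIntegralElem.of_comp this

/-- For `e = ∑ xᵢ ⊗ yᵢ` take `L b = ∑ xᵢ ⊗ Tr (yᵢ b)`. Invariant factors leave the trace and cross
the tensor sign, so both composites are sums over `g` in which only `g = 1` survives. Thus `d`
annihilates the kernel and the cokernel of `μ`. -/
lemma IsGaloisDenominator.exists_section [Finite G] {d : S} (hd : IsGaloisDenominator β d)
    (hβα : ∀ g s, α g (algebraMap S B s) = algebraMap S B (β g s)) :
    ∃ L : B →+ S ⊗[invariants β] invariants α,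
      (∀ a, L (mulInvariants β α a) = d • a) ∧ ∀ b, mulInvariants β α (L b) = d • b := by
  classical
  cases nonempty_fintype G
  -- Both formulas are additive in `e`, so for arbitrary `e` it suffices to treat pure tensors. The
  -- vanishing for `g ≠ 1` enters only afterwards.
  have key : ∀ e : S ⊗[K] S, ∃ L : B →+ S ⊗[invariants β] invariants α,
      (∀ (s : S) (t : invariants α), L (algebraMap S B s * t) =
        (∑ g, twistedMul β g e * β g s) ⊗ₜ t) ∧
      ∀ b, mulInvariants β α (L b) = ∑ g, twistedMul β g e • α g b := by
    intro e
    induction e using TensorProduct.induction_on with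
    | zero => exact ⟨0, by simp, by simp⟩
    | add e₁ e₂ h₁ h₂ =>
      obtain ⟨L₁, h₁, h₁'⟩ := h₁
      obtain ⟨L₂, h₂, h₂'⟩ := h₂
      exact ⟨L₁ + L₂, by simp [h₁, h₂, add_mul, Finset.sum_add_distrib, TensorProduct.add_tmul],
        by simp [h₁', h₂', add_smul, Finset.sum_add_distrib]⟩
    | tmul x y =>
      refine ⟨(TensorProduct.mk (invariants β) S (invariants α) x).toAddMonoidHom.comp
        ((invariantTrace α).comp (AddMonoidHom.mulLeft (algebraMap S B y))), fun s t => ?_,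
        fun b => ?_⟩
      · have : invariantTrace α (algebraMap S B y * (algebraMap S B s * t)) =
            invariantTrace β (y * s) • t := by
          ext
          rw [coe_invariantTrace, Algebra.smul_def, MulMemClass.coe_mul]
          change _ = algebraMap (invariants α) B (algebraMap (invariants β) (invariants α) _) * _
          rw [← IsScalarTower.algebraMap_apply]
          change _ = algebraMap S B (invariantTrace β (y * s) : S) * _
          rw [coe_invariantTrace, map_sum, Finset.sum_mul]
          refine Finset.sum_congr rfl fun g _ => ?_
          rw [map_mul, map_mul, hβα, hβα, t.2 g]
          simp [mul_assoc]
        change x ⊗ₜ invariantTrace α (algebraMap S B y * (algebraMap S B s * t)) = _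
        rw [this, ← TensorProduct.smul_tmul, Algebra.smul_def]
        congr 1
        change (invariantTrace β (y * s) : S) * x = _
        rw [coe_invariantTrace, Finset.sum_mul]
        refine Finset.sum_congr rfl fun g _ => ?_
        simp
        ring
      · change mulInvariants β α (x ⊗ₜ invariantTrace α (algebraMap S B y * b)) = _
        rw [mulInvariants_tmul, coe_invariantTrace, Finset.mul_sum]
        refine Finset.sum_congr rfl fun g _ => ?_
        simp [hβα, Algebra.smul_def, mul_assoc]
  obtain ⟨e, he, he'⟩ := hd
  obtain ⟨L, hL, hL'⟩ := key e
  refine ⟨L, fun a => ?_, fun b => ?_⟩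
  · induction a using TensorProduct.induction_on with
    | zero => simp
    | add a₁ a₂ h₁ h₂ => simp only [map_add, h₁, h₂, smul_add]
    | tmul s t =>
      rw [mulInvariants_tmul, hL, Finset.sum_eq_single 1]
      · simp [he, TensorProduct.smul_tmul']
      · intro g _ hg
        simp [he' g hg]
      · simp
  · rw [hL', Finset.sum_eq_single 1]
    · simp [he]
    · intro g _ hg
      simp [he' g hg]
    · simp

/-- The kernel of the multiplication `S ⊗ B^G → B` is nil. -/
theorem isNilpotent_of_mulInvariants_eq_zero [Finite G]
    (hβα : ∀ g s, α g (algebraMap S B s) = algebraMap S B (β g s))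
    (a : S ⊗[invariants β] invariants α) (ha : mulInvariants β α a = 0) : IsNilpotent a := by
  classical
  cases nonempty_fintype G
  -- The element is lifted to a polynomial ring over `S` on which `G` acts coefficientwise. There
  -- the invariants are exactly the polynomials over `S^G`, whereas invariants of the tensor product
  -- need not come from `B^G` without flatness.
  let ev : MvPolynomial (invariants α) S →ₐ[S] S ⊗[invariants β] invariants α :=
    MvPolynomial.aeval fun t => 1 ⊗ₜ t
  let γ : G → (MvPolynomial (invariants α) S →+* MvPolynomial (invariants α) S) := fun g =>
    MvPolynomial.map ((β g : S ≃ₐ[K] S) : S →+* S)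
  have hev : ∀ a, ∃ q, ev q = a := by
    intro a
    induction a using TensorProduct.induction_on with
    | zero => exact ⟨0, map_zero _⟩
    | add a₁ a₂ h₁ h₂ =>
      obtain ⟨q₁, rfl⟩ := h₁
      obtain ⟨q₂, rfl⟩ := h₂
      exact ⟨q₁ + q₂, map_add _ _ _⟩
    | tmul s t =>
      refine ⟨MvPolynomial.C s * MvPolynomial.X t, ?_⟩
      simp [ev]
  have hγ : ∀ g q, mulInvariants β α (ev (γ g q)) = α g (mulInvariants β α (ev q)) := by
    intro g q
    induction q using MvPolynomial.induction_on with
    | C s => simp [γ, ev, hβα]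
    | add p q hp hq => simp only [map_add, hp, hq]
    | mul_X q t hq =>
      rw [map_mul, map_mul, map_mul, hq, map_mul, map_mul, map_mul]
      congr 1
      simp [γ, ev, t.2 g]
  obtain ⟨q, rfl⟩ := hev a
  let P : Polynomial (MvPolynomial (invariants α) S) :=
    ∏ g : G, (Polynomial.X - Polynomial.C (γ g q))
  have hP : ∀ h, P.map (γ h) = P := by
    intro h
    rw [Polynomial.map_prod]
    refine Fintype.prod_equiv (Equiv.mulLeft h) _ _ fun g => ?_
    have : γ h (γ g q) = γ (h * g) q := by
      simp only [γ, MvPolynomial.map_map, map_mul]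
      rfl
    simp [this]
  -- The coefficients of `P` are invariant, hence lie over `S^G`, so their images have the form `1 ⊗
  -- c` with `c` in `B^G`.
  have hcoeff : ∀ n, ev (P.coeff n) = 1 ⊗ₜ (if n = Fintype.card G then 1 else 0) := by
    intro n
    have hmem : P.coeff n ∈ Set.range (MvPolynomial.map (σ := invariants α)
        (invariants β).val.toRingHom) := by
      rw [MvPolynomial.mem_range_map_iff_coeffs_subset]
      intro c hc
      obtain ⟨k, -, rfl⟩ := MvPolynomial.mem_coeffs_iff.mp hc
      refine ⟨⟨MvPolynomial.coeff k (P.coeff n), fun h => ?_⟩, rfl⟩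
      have := congrArg (fun p => (p.coeff n).coeff k) (hP h)
      simpa [γ, Polynomial.coeff_map, MvPolynomial.coeff_map] using this
    obtain ⟨c, hc⟩ := hmem
    have hc' : ∀ c : MvPolynomial (invariants α) (invariants β),
        ev (MvPolynomial.map (invariants β).val.toRingHom c) =
          1 ⊗ₜ MvPolynomial.aeval id c := by
      intro c
      induction c using MvPolynomial.induction_on with
      | C r =>
        simp only [MvPolynomial.map_C, MvPolynomial.aeval_C, ev]
        rw [Algebra.algebraMap_eq_smul_one (A := invariants α), ← TensorProduct.smul_tmul,
          Algebra.TensorProduct.algebraMap_apply, Algebra.smul_def]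
        simp
      | add p q hp hq => simp only [map_add, hp, hq, TensorProduct.tmul_add]
      | mul_X p t hp =>
        rw [map_mul, map_mul, hp, map_mul]
        simp [ev]
    rw [← hc]
    erw [hc']
    congr 1
    ext
    -- Since `B^G` embeds in `B`, the element `c` is determined there, where `P` becomes `∏ (X - g
    -- μ(a)) = X ^ |G|`.
    have h1 : mulInvariants β α (ev (P.coeff n)) =
        (Polynomial.X ^ Fintype.card G : Polynomial B).coeff n := by
      have : P.map ((mulInvariants β α).comp ev : _ →+* B) = Polynomial.X ^ Fintype.card G := by
        rw [Polynomial.map_prod]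
        simp [hγ, ha]
      rw [← this, Polynomial.coeff_map]
      rfl
    rw [← hc] at h1
    erw [hc'] at h1
    rw [mulInvariants_tmul, Polynomial.coeff_X_pow, map_one, one_mul] at h1
    rw [h1]
    split_ifs <;> rfl
  have hmap : P.map (ev : _ →+* S ⊗[invariants β] invariants α) =
      Polynomial.X ^ Fintype.card G := by
    ext n
    rw [Polynomial.coeff_map, Polynomial.coeff_X_pow]
    erw [hcoeff]
    split_ifs
    · rfl
    · simp
  have heval : P.eval q = 0 := by
    rw [Polynomial.eval_prod]
    refine Finset.prod_eq_zero (Finset.mem_univ 1) ?_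
    have : γ 1 q = q := by
      simp only [γ, map_one]
      exact MvPolynomial.map_id q
    simp [this]
  refine ⟨Fintype.card G, ?_⟩
  have := congrArg (ev : _ →+* S ⊗[invariants β] invariants α) heval
  rw [← Polynomial.eval_map_apply, hmap] at this
  simpa using this

theorem isIntegralBirational_mulInvariants [Finite G] [IsDomain S] [IsDomain B]
    (hβ : Function.Injective β) (hSB : Function.Injective (algebraMap S B))
    (hβα : ∀ g s, α g (algebraMap S B s) = algebraMap S B (β g s)) :
    IsIntegralBirational (mulInvariants β α : S ⊗[invariants β] invariants α →+* B) where
  isIntegral := isIntegral_mulInvariants β α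
  isNilpotent := isNilpotent_of_mulInvariants_eq_zero β α hβα
  exists_mul_eq b := by
    obtain ⟨d, hd, hd'⟩ := exists_isGaloisDenominator_ne_zero β hβ
    obtain ⟨L, -, hL⟩ := hd'.exists_section β α hβα
    refine ⟨d ⊗ₜ 1, L b, ?_, ?_⟩
    · simpa using (map_ne_zero_iff _ hSB).mpr hd
    · simp [hL, Algebra.smul_def]

end InvariantTensor

/-! ### Finiteness, surjectivity and normalization for schemes -/

section Scheme

open scoped TensorProduct

variable {K S : Type u} {G : Type v} [Field K] [CommRing S] [Algebra K S] [Group G] {m : ℕ}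
  (β : G →* (S ≃ₐ[K] S)) (ρ : G →* Matrix.GeneralLinearGroup (Fin m) K)

noncomputable instance invariantsProductAlgebra :
    Algebra (invariants β) (invariants (productAction β ρ)) :=
  (invariantsC β ρ).toAlgebra

instance invariantsProduct_isScalarTower :
    IsScalarTower (invariants β) (invariants (productAction β ρ)) (MvPolynomial (Fin m) S) :=
  IsScalarTower.of_algebraMap_eq fun _ => rfl

lemma productAction_apply (g : G) (f : MvPolynomial (Fin m) S) :
    productAction β ρ g f = productActionHom β ρ g f := rfl

lemma productAction_algebraMap (g : G) (s : S) :
    productAction β ρ g (algebraMap S (MvPolynomial (Fin m) S) s) = algebraMap S _ (β g s) :=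
  productActionHom_C β ρ g s

/-- The pull-back `Y ×_X Z_ρ` is the spectrum of the tensor product. -/
noncomputable def pullbackIso :
    pullbackScheme β ρ ≅ Spec (.of (S ⊗[invariants β] invariants (productAction β ρ))) :=
  pullbackSpecIso (invariants β) S (invariants (productAction β ρ))

lemma pullbackIso_inv_fst : (pullbackIso β ρ).inv ≫ pullback.fst _ _ =
    Spec.map (CommRingCat.ofHom Algebra.TensorProduct.includeLeftRingHom) :=
  pullbackSpecIso_inv_fst (invariants β) S (invariants (productAction β ρ))

lemma pullbackIso_inv_snd : (pullbackIso β ρ).inv ≫ pullback.snd _ _ =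
    Spec.map (CommRingCat.ofHom (R := invariants (productAction β ρ))
      (S := S ⊗[invariants β] invariants (productAction β ρ))
      Algebra.TensorProduct.includeRight.toRingHom) :=
  pullbackSpecIso_inv_snd (invariants β) S (invariants (productAction β ρ))

/-- The multiplication `S ⊗ S[W]^G → S[W]`. -/
noncomputable abbrev mulMap :
    S ⊗[invariants β] invariants (productAction β ρ) →+* MvPolynomial (Fin m) S :=
  (mulInvariants β (productAction β ρ)).toRingHom

lemma toPullback_eq : toPullback β ρ =
    Spec.map (CommRingCat.ofHom (mulMap β ρ)) ≫ (pullbackIso β ρ).inv := by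
  apply pullback.hom_ext
  · rw [Category.assoc, pullbackIso_inv_fst, ← Spec.map_comp, ← CommRingCat.ofHom_comp,
      toPullback, pullback.lift_fst]
    refine congrArg (fun f => Spec.map (CommRingCat.ofHom f)) (RingHom.ext fun s => ?_)
    simp [MvPolynomial.algebraMap_eq]
  · rw [Category.assoc, pullbackIso_inv_snd, ← Spec.map_comp, ← CommRingCat.ofHom_comp,
      toPullback, pullback.lift_snd]
    refine congrArg (fun f => Spec.map (CommRingCat.ofHom f)) (RingHom.ext fun s => ?_)
    simp

lemma toPullback_fst : toPullback β ρ ≫ pullback.fst _ _ = bundleProj S m :=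
  pullback.lift_fst _ _ _

lemma toPullback_snd :
    toPullback β ρ ≫ pullback.snd _ _ = quotientMap (productAction β ρ) :=
  pullback.lift_snd _ _ _

lemma pullbackAct_fst (g : G) :
    pullbackAct β ρ g ≫ pullback.fst _ _ = pullback.fst _ _ ≫ specAct β g :=
  pullback.lift_fst _ _ _

lemma pullbackAct_snd (g : G) :
    pullbackAct β ρ g ≫ pullback.snd _ _ = pullback.snd _ _ :=
  pullback.lift_snd _ _ _

lemma specAct_bundleProj (g : G) :
    specAct (productAction β ρ) g ≫ bundleProj S m = bundleProj S m ≫ specAct β g := by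
  simp only [specAct, bundleProj, ← Spec.map_comp, ← CommRingCat.ofHom_comp]
  congr 2
  ext s : 1
  exact productActionHom_C β ρ g⁻¹ s

theorem toPullback_equivariant (g : G) :
    specAct (productAction β ρ) g ≫ toPullback β ρ = toPullback β ρ ≫ pullbackAct β ρ g := by
  apply pullback.hom_ext
  · rw [Category.assoc, Category.assoc, toPullback_fst, pullbackAct_fst, ← Category.assoc,
      toPullback_fst, specAct_bundleProj]
  · rw [Category.assoc, Category.assoc, toPullback_snd, pullbackAct_snd, toPullback_snd,
      specAct_quotientMap]

theorem isFinite_toPullback [Finite G] : IsFinite (toPullback β ρ) := by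
  have : IsFinite (Spec.map (CommRingCat.ofHom (mulMap β ρ))) := by
    rw [IsFinite.SpecMap_iff]
    refine RingHom.IsIntegral.to_finite (isIntegral_mulInvariants β (productAction β ρ)) ?_
    -- `B` is of finite type already over `S`, and an integral map of finite type is finite.
    refine RingHom.FiniteType.of_comp_finiteType
      (f := Algebra.TensorProduct.includeLeftRingHom) ?_
    have : (mulMap β ρ).comp Algebra.TensorProduct.includeLeftRingHom =
        algebraMap S (MvPolynomial (Fin m) S) := by
      ext s : 1
      simp
    rw [CommRingCat.hom_ofHom, this, RingHom.finiteType_algebraMap]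
    infer_instance
  rw [toPullback_eq]
  infer_instance

theorem surjective_toPullback [Finite G] : Surjective (toPullback β ρ) := by
  have : Surjective (Spec.map (CommRingCat.ofHom (mulMap β ρ))) := by
    refine ⟨fun p => ?_⟩
    have : p.asIdeal.IsPrime := PrimeSpectrum.isPrime p
    let := (mulMap β ρ).toAlgebra
    have : Algebra.IsIntegral (S ⊗[invariants β] invariants (productAction β ρ))
      (MvPolynomial (Fin m) S) := ⟨isIntegral_mulInvariants β (productAction β ρ)⟩
    -- A nil kernel lies in every prime, so lying over applies to every point.
    have hp : RingHom.ker (mulMap β ρ) ≤ p.asIdeal := fun a ha =>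
      (nilradical_le_prime p.asIdeal) (mem_nilradical.mpr
        (isNilpotent_of_mulInvariants_eq_zero β _ (productAction_algebraMap β ρ) a ha))
    obtain ⟨Q, -, hQ, hQp⟩ :=
      Ideal.exists_ideal_over_prime_of_isIntegral p.asIdeal (⊥ : Ideal (MvPolynomial (Fin m) S)) hp
    exact ⟨⟨Q, hQ⟩, PrimeSpectrum.ext hQp⟩
  rw [toPullback_eq]
  infer_instance

instance [IsDomain S] [IsIntegrallyClosed S] :
    IsIntegrallyClosed (MvPolynomial (Fin m) S) :=
  isIntegrallyClosed_mvPolynomial_fin S m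

/-- The extra isomorphism `e` allows the bundles of two representations to be compared as
normalizations of one scheme. -/
theorem isNormalization_toPullback_comp [Finite G] [IsDomain S] [IsIntegrallyClosed S]
    (hβ : Function.Injective β) {W : Scheme.{u}} [IsAffine W] (e : pullbackScheme β ρ ≅ W) :
    IsNormalization (toPullback β ρ ≫ e.hom) := by
  have h := isIntegralBirational_mulInvariants β (productAction β ρ) hβ
    (MvPolynomial.C_injective _ _) (productAction_algebraMap β ρ)
  let eB := (Scheme.ΓSpecIso (.of (MvPolynomial (Fin m) S))).symm.commRingCatIsoToRingEquiv
  have : IsDomain Γ(bundle S m, ⊤) := eB.symm.injective.isDomain eB.symm.toRingHom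
  have : IsIntegrallyClosed Γ(bundle S m, ⊤) := IsIntegrallyClosed.of_equiv eB
  let i : Spec (.of (S ⊗[invariants β] invariants (productAction β ρ))) ≅ W :=
    (pullbackIso β ρ).symm ≪≫ e
  let eA : Γ(W, ⊤) ≃+* S ⊗[invariants β] invariants (productAction β ρ) :=
    (Scheme.Γ.mapIso i.op ≪≫ Scheme.ΓSpecIso _).commRingCatIsoToRingEquiv
  have := (h.comp_ringEquiv eA eB).isRingNormalization
  unfold IsNormalization
  convert this using 1
  rw [toPullback_eq, Category.assoc]
  change (Scheme.Hom.appTop (Spec.map (CommRingCat.ofHom (mulMap β ρ)) ≫ i.hom)).hom = _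
  rw [Scheme.Hom.comp_appTop]
  have h2 := Scheme.ΓSpecIso_naturality (CommRingCat.ofHom (mulMap β ρ))
  rw [← Iso.eq_comp_inv] at h2
  rw [h2]
  rfl

theorem isNormalization_toPullback [Finite G] [IsDomain S] [IsIntegrallyClosed S]
    (hβ : Function.Injective β) : IsNormalization (toPullback β ρ) := by
  simpa using isNormalization_toPullback_comp β ρ hβ (Iso.refl _)

lemma IsNormalization.exists_iso {N N' W : Scheme.{u}} [IsAffine N] [IsAffine N'] [IsAffine W]
    {f : N ⟶ W} {f' : N' ⟶ W} (hf : IsNormalization f) (hf' : IsNormalization f') :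
    ∃ e : N ≅ N', e.hom ≫ f' = f := by
  obtain ⟨e, he⟩ := IsRingNormalization.exists_ringEquiv hf' hf
  let j : Γ(N', ⊤) ≅ Γ(N, ⊤) := e.toCommRingCatIso
  refine ⟨N.isoSpec ≪≫ Scheme.Spec.mapIso j.op ≪≫ N'.isoSpec.symm, ?_⟩
  have : f'.appTop ≫ j.hom = f.appTop := CommRingCat.hom_ext he
  change (N.isoSpec.hom ≫ Spec.map j.hom ≫ N'.isoSpec.inv) ≫ f' = f
  rw [Category.assoc, Category.assoc, ← Scheme.isoSpec_inv_naturality, ← Spec.map_comp_assoc, this,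
    Scheme.isoSpec_inv_naturality, Iso.hom_inv_id_assoc]

end Scheme

/-! ### Uniqueness and existence of lifts -/

section Lifting

variable {K S : Type u} {G : Type v} [Field K] [CommRing S] [Algebra K S] [Group G] {m m' : ℕ}
  (β : G →* (S ≃ₐ[K] S)) (ρ : G →* Matrix.GeneralLinearGroup (Fin m) K)
  (ρ' : G →* Matrix.GeneralLinearGroup (Fin m') K)

/-- For a nonzero denominator `d`, every `d * b` is in the image of `μ`, where `u₁` and `u₂` agree.
Injectivity on constants keeps the image of `d` nonzero, so it cancels in the domain `C`. -/
lemma ringHom_ext_of_comp_mulMap [Finite G] [IsDomain S] (hβ : Function.Injective β) {C : Type u}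
    [CommRing C] [IsDomain C] {u₁ u₂ : MvPolynomial (Fin m) S →+* C}
    (h : u₁.comp (mulMap β ρ) = u₂.comp (mulMap β ρ))
    (hinj : Function.Injective (u₁.comp MvPolynomial.C)) : u₁ = u₂ := by
  obtain ⟨d, hd, hd'⟩ := exists_isGaloisDenominator_ne_zero β hβ
  obtain ⟨L, -, hL⟩ := hd'.exists_section β (productAction β ρ) (productAction_algebraMap β ρ)
  have hC : u₁ (MvPolynomial.C d) = u₂ (MvPolynomial.C d) := by
    simpa [MvPolynomial.algebraMap_eq] using congrArg (fun f => f (d ⊗ₜ 1)) h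
  have hne : u₁ (MvPolynomial.C d) ≠ 0 := by
    intro h0
    exact hd (hinj (by simpa using h0))
  refine RingHom.ext fun b => ?_
  have hb : u₁ (d • b) = u₂ (d • b) := by
    rw [← hL]
    exact congrArg (fun f => f (L b)) h
  rw [MvPolynomial.smul_eq_C_mul, map_mul, map_mul, ← hC] at hb
  exact mul_left_cancel₀ hne hb

/-- The injective `σ` describes the morphism on the base: `β g⁻¹` for lifts of the action of `g`,
the identity for lifts of `θ`. -/
lemma bundle_hom_ext [Finite G] [IsDomain S] (hβ : Function.Injective β)
    {f₁ f₂ : bundle S m ⟶ bundle S m'} (h : f₁ ≫ toPullback β ρ' = f₂ ≫ toPullback β ρ')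
    (σ : S →+* S) (hσ : Function.Injective σ)
    (h₁ : f₁ ≫ bundleProj S m' = bundleProj S m ≫ Spec.map (CommRingCat.ofHom σ)) : f₁ = f₂ := by
  obtain ⟨u₁, rfl⟩ := Spec.map_surjective f₁
  obtain ⟨u₂, rfl⟩ := Spec.map_surjective f₂
  rw [toPullback_eq, ← Category.assoc, ← Category.assoc, cancel_mono, ← Spec.map_comp,
    ← Spec.map_comp] at h
  rw [bundleProj, bundleProj, ← Spec.map_comp, ← Spec.map_comp] at h₁
  have h' := congrArg CommRingCat.Hom.hom (Spec.map_injective h)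
  have h₁' := congrArg CommRingCat.Hom.hom (Spec.map_injective h₁)
  congr 1
  refine CommRingCat.hom_ext (ringHom_ext_of_comp_mulMap β ρ' hβ h' ?_)
  change Function.Injective (u₁.hom.comp MvPolynomial.C)
  rw [show u₁.hom.comp MvPolynomial.C = (MvPolynomial.C (σ := Fin m)).comp σ from h₁']
  exact (MvPolynomial.C_injective _ _).comp hσ

theorem eq_specAct_of_comp_toPullback [Finite G] [IsDomain S] (hβ : Function.Injective β) (g : G)
    (ψ : bundle S m ⟶ bundle S m)
    (h : ψ ≫ toPullback β ρ = toPullback β ρ ≫ pullbackAct β ρ g) :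
    ψ = specAct (productAction β ρ) g :=
  (bundle_hom_ext β ρ hβ ((toPullback_equivariant β ρ g).trans h.symm) _ (β g⁻¹).injective
    (specAct_bundleProj β ρ g)).symm

variable {ρ ρ'}

lemma pullbackMap_fst (θ : Zrho β ρ ⟶ Zrho β ρ') (hθ : θ ≫ ZrhoToX β ρ' = ZrhoToX β ρ) :
    pullbackMap β ρ ρ' θ hθ ≫ pullback.fst _ _ = pullback.fst _ _ :=
  pullback.lift_fst _ _ _

lemma pullbackMap_snd (θ : Zrho β ρ ⟶ Zrho β ρ') (hθ : θ ≫ ZrhoToX β ρ' = ZrhoToX β ρ) :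
    pullbackMap β ρ ρ' θ hθ ≫ pullback.snd _ _ = pullback.snd _ _ ≫ θ :=
  pullback.lift_snd _ _ _

lemma pullbackMap_pullbackAct (θ : Zrho β ρ ⟶ Zrho β ρ') (hθ : θ ≫ ZrhoToX β ρ' = ZrhoToX β ρ)
    (g : G) : pullbackMap β ρ ρ' θ hθ ≫ pullbackAct β ρ' g =
      pullbackAct β ρ g ≫ pullbackMap β ρ ρ' θ hθ := by
  apply pullback.hom_ext
  · rw [Category.assoc, Category.assoc, pullbackAct_fst, pullbackMap_fst, pullbackAct_fst,
      ← Category.assoc, pullbackMap_fst]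
  · rw [Category.assoc, Category.assoc, pullbackAct_snd, pullbackMap_snd, ← Category.assoc,
      pullbackAct_snd]

/-- An isomorphism of the quotients over `X` induces an isomorphism of the pull-backs to `Y`. -/
noncomputable def pullbackMapIso (θ : Zrho β ρ ≅ Zrho β ρ')
    (hθ : θ.hom ≫ ZrhoToX β ρ' = ZrhoToX β ρ) : pullbackScheme β ρ ≅ pullbackScheme β ρ' where
  hom := pullbackMap β ρ ρ' θ.hom hθ
  inv := pullbackMap β ρ' ρ θ.inv (by rw [← hθ, Iso.inv_hom_id_assoc])
  hom_inv_id := by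
    apply pullback.hom_ext
    · rw [Category.assoc, pullbackMap_fst, pullbackMap_fst, Category.id_comp]
    · rw [Category.assoc, pullbackMap_snd, ← Category.assoc, pullbackMap_snd, Category.assoc,
        Iso.hom_inv_id, Category.comp_id, Category.id_comp]
  inv_hom_id := by
    apply pullback.hom_ext
    · rw [Category.assoc, pullbackMap_fst, pullbackMap_fst, Category.id_comp]
    · rw [Category.assoc, pullbackMap_snd, ← Category.assoc, pullbackMap_snd, Category.assoc,
        Iso.inv_hom_id, Category.comp_id, Category.id_comp]

lemma comp_bundleProj_of_lift {θ : Zrho β ρ ⟶ Zrho β ρ'}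
    {hθ : θ ≫ ZrhoToX β ρ' = ZrhoToX β ρ} {Θ : bundle S m ⟶ bundle S m'}
    (h : Θ ≫ toPullback β ρ' = toPullback β ρ ≫ pullbackMap β ρ ρ' θ hθ) :
    Θ ≫ bundleProj S m' = bundleProj S m := by
  rw [← toPullback_fst β ρ', ← Category.assoc, h, Category.assoc, pullbackMap_fst, toPullback_fst]

/-- Both composites lift the same morphism of pull-backs, since `id × θ` commutes with the action on
the first factor. -/
lemma equivariant_of_lift [Finite G] [IsDomain S] (hβ : Function.Injective β)
    {θ : Zrho β ρ ⟶ Zrho β ρ'}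
    {hθ : θ ≫ ZrhoToX β ρ' = ZrhoToX β ρ} {Θ : bundle S m ⟶ bundle S m'}
    (h : Θ ≫ toPullback β ρ' = toPullback β ρ ≫ pullbackMap β ρ ρ' θ hθ) (g : G) :
    specAct (productAction β ρ) g ≫ Θ = Θ ≫ specAct (productAction β ρ') g := by
  refine bundle_hom_ext β ρ' hβ ?_ (β g⁻¹ : S ≃ₐ[K] S).toAlgHom.toRingHom (β g⁻¹).injective ?_
  · rw [Category.assoc, Category.assoc, h, toPullback_equivariant, ← Category.assoc,
      toPullback_equivariant, ← Category.assoc Θ, h, Category.assoc, Category.assoc,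
      pullbackMap_pullbackAct]
  · rw [Category.assoc, comp_bundleProj_of_lift β h]
    exact specAct_bundleProj β ρ g

theorem exists_lift [Finite G] [IsDomain S] [IsIntegrallyClosed S] (hβ : Function.Injective β)
    (θ : Zrho β ρ ≅ Zrho β ρ') (hθ : θ.hom ≫ ZrhoToX β ρ' = ZrhoToX β ρ) :
    ∃ Θ : bundle S m ≅ bundle S m',
      Θ.hom ≫ toPullback β ρ' = toPullback β ρ ≫ pullbackMap β ρ ρ' θ.hom hθ :=
  IsNormalization.exists_iso
    (isNormalization_toPullback_comp β ρ hβ (pullbackMapIso β θ hθ))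
    (isNormalization_toPullback β ρ' hβ)

end Lifting

/-! ### Linearizing an equivariant isomorphism -/

section Linear

open MvPolynomial

variable {K S : Type u} {G : Type v} [Field K] [CommRing S] [Algebra K S] [Group G] {m m' : ℕ}
  (β : G →* (S ≃ₐ[K] S)) {ρ : G →* Matrix.GeneralLinearGroup (Fin m) K}
  {ρ' : G →* Matrix.GeneralLinearGroup (Fin m') K}

lemma linearMorphism_comp {m'' : ℕ} (M : Matrix (Fin m') (Fin m) S)
    (N : Matrix (Fin m'') (Fin m') S) :
    linearMorphism M ≫ linearMorphism N = linearMorphism (N * M) := by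
  simp only [linearMorphism, ← Spec.map_comp, ← CommRingCat.ofHom_comp]
  refine congrArg (fun f => Spec.map (CommRingCat.ofHom f)) (MvPolynomial.ringHom_ext ?_ ?_)
  · intro s
    simp
  · intro i
    simp [Matrix.mul_apply, Finset.mul_sum, Finset.sum_mul, mul_assoc]
    rw [Finset.sum_comm]

lemma linearMorphism_one : linearMorphism (1 : Matrix (Fin m) (Fin m) S) = 𝟙 _ := by
  simp only [linearMorphism, ← Spec.map_id, ← CommRingCat.ofHom_id]
  refine congrArg (fun f => Spec.map (CommRingCat.ofHom f)) (MvPolynomial.ringHom_ext ?_ ?_)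
  · intro s
    simp
  · intro i
    simp [Matrix.one_apply, apply_ite]

lemma isIso_linearMorphism {M : Matrix (Fin m') (Fin m) S} {N : Matrix (Fin m) (Fin m') S}
    (h₁ : M * N = 1) (h₂ : N * M = 1) : IsIso (linearMorphism M) :=
  ⟨linearMorphism N, by rw [linearMorphism_comp, h₂, linearMorphism_one],
    by rw [linearMorphism_comp, h₁, linearMorphism_one]⟩

/-- A matrix intertwining the two actions defines an equivariant morphism. -/
lemma linearMorphism_equivariant {M : Matrix (Fin m') (Fin m) S} {g : G}
    (hM : ∀ i k, ∑ j, β g⁻¹ (M i j) * algebraMap K S ((ρ g⁻¹⁻¹).val j k) =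
      ∑ l, algebraMap K S ((ρ' g⁻¹⁻¹).val i l) * M l k) :
    specAct (productAction β ρ) g ≫ linearMorphism M =
      linearMorphism M ≫ specAct (productAction β ρ') g := by
  simp only [linearMorphism, specAct, ← Spec.map_comp, ← CommRingCat.ofHom_comp]
  generalize g⁻¹ = g at hM
  let u : MvPolynomial (Fin m') S →ₐ[S] MvPolynomial (Fin m) S :=
    aeval fun i : Fin m' => ∑ j, C (M i j) * X j
  have hC : ∀ s, productActionHom β ρ g (u (C s)) = u (productActionHom β ρ' g (C s)) := by
    intro s
    simp [u]
  have hX : ∀ i, productActionHom β ρ g (u (X i)) = u (productActionHom β ρ' g (X i)) := by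
    intro i
    have hu : ∀ i, u (X i) = ∑ j, C (M i j) * X j := fun i => aeval_X _ i
    have hu' : ∀ s, u (C s) = C s := fun s => u.commutes s
    rw [productActionHom_X, hu, map_sum, map_sum]
    simp_rw [map_mul, productActionHom_C, productActionHom_X, hu, hu', Finset.mul_sum]
    refine Finset.sum_comm.trans (Eq.trans ?_ Finset.sum_comm)
    refine Finset.sum_congr rfl fun k _ => ?_
    simp_rw [← mul_assoc, ← Finset.sum_mul, ← map_mul, ← map_sum, hM]
  exact congrArg (fun f => Spec.map (CommRingCat.ofHom f)) (MvPolynomial.ringHom_ext hC hX)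

/-- The linear part of a transformed polynomial. -/
lemma constantCoeff_pderiv_productAction (g : G) (f : MvPolynomial (Fin m) S) (k : Fin m) :
    constantCoeff (pderiv k (productAction β ρ g f)) =
      ∑ j, β g (constantCoeff (pderiv j f)) * algebraMap K S ((ρ g⁻¹).val j k) := by
  let l : Fin m → MvPolynomial (Fin m) S := fun j =>
    ∑ k, C (algebraMap K S ((ρ g⁻¹).val j k)) * X k
  have h : ∀ p, productAction β ρ g p = aeval l (map ((β g : S ≃ₐ[K] S) : S →+* S) p) := by
    intro p
    rw [productAction_apply]
    induction p using MvPolynomial.induction_on with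
    | C s => simp
    | add p q hp hq => simp only [map_add, hp, hq]
    | mul_X p j hp => simp [hp, l]
  -- The substitution `l` is linear, so it fixes the origin.
  have hl : ∀ p, constantCoeff (aeval l p) = constantCoeff p := by
    intro p
    induction p using MvPolynomial.induction_on with
    | C s => simp
    | add p q hp hq => simp only [map_add, hp, hq]
    | mul_X p j hp => simp [l]
  rw [h, pderiv_aeval_eq_sum, map_sum]
  refine Finset.sum_congr rfl fun j _ => ?_
  have hlk : pderiv k (l j) = C (algebraMap K S ((ρ g⁻¹).val j k)) := by
    simp only [l, map_sum, Derivation.leibniz, pderiv_X, pderiv_C, smul_eq_mul, mul_zero, add_zero]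
    rw [Finset.sum_eq_single k]
    · simp
    · intro i _ hik
      simp [hik]
    · simp
  rw [map_mul, hl, pderiv_map, hlk, constantCoeff_C, constantCoeff_map]
  rfl

/-- The Jacobian of `Θ` along the zero section works: differentiating the equivariance there gives
the intertwining relation because the actions are linear. -/
theorem exists_linear_equivariant (Θ : bundle S m ≅ bundle S m')
    (hΘ : Θ.hom ≫ bundleProj S m' = bundleProj S m)
    (hG : ∀ g : G, specAct (productAction β ρ) g ≫ Θ.hom =
      Θ.hom ≫ specAct (productAction β ρ') g) :
    ∃ M : Matrix (Fin m') (Fin m) S, IsIso (linearMorphism M) ∧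
      ∀ g : G, specAct (productAction β ρ) g ≫ linearMorphism M =
        linearMorphism M ≫ specAct (productAction β ρ') g := by
  obtain ⟨u, hu⟩ := Spec.map_surjective Θ.hom
  obtain ⟨v, hv⟩ := Spec.map_surjective Θ.inv
  have hΘ' : Θ.inv ≫ bundleProj S m = bundleProj S m' := by rw [← hΘ, Iso.inv_hom_id_assoc]
  rw [← hu, bundleProj, bundleProj, ← Spec.map_comp] at hΘ
  rw [← hv, bundleProj, bundleProj, ← Spec.map_comp] at hΘ'
  have huC : ∀ s, u.hom (C s) = C s := fun s =>
    congrArg (fun f => f.hom s) (Spec.map_injective hΘ)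
  have hvC : ∀ s, v.hom (C s) = C s := fun s =>
    congrArg (fun f => f.hom s) (Spec.map_injective hΘ')
  have huv : ∀ p, u.hom (v.hom p) = p := fun p => by
    have := Θ.hom_inv_id
    rw [← hu, ← hv, ← Spec.map_comp, ← Spec.map_id] at this
    exact congrArg (fun f => f.hom p) (Spec.map_injective this)
  have hvu : ∀ p, v.hom (u.hom p) = p := fun p => by
    have := Θ.inv_hom_id
    rw [← hu, ← hv, ← Spec.map_comp, ← Spec.map_id] at this
    exact congrArg (fun f => f.hom p) (Spec.map_injective this)
  have huG : ∀ g p, productAction β ρ g (u.hom p) = u.hom (productAction β ρ' g p) := fun g p => by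
    -- The comorphism of the action of `g⁻¹` is the algebra action of `g`.
    have := hG g⁻¹
    rw [← hu, specAct, specAct, ← Spec.map_comp, ← Spec.map_comp] at this
    have := congrArg (fun f => f.hom p) (Spec.map_injective this)
    rw [inv_inv] at this
    exact this
  let f : Fin m' → MvPolynomial (Fin m) S := fun i => u.hom (X i)
  let h : Fin m → MvPolynomial (Fin m') S := fun j => v.hom (X j)
  have huf : ∀ p, aeval f p = u.hom p := fun p => by
    induction p using MvPolynomial.induction_on with
    | C s => rw [huC]; simp
    | add p q hp hq => simp only [map_add, hp, hq]
    | mul_X p j hp => rw [map_mul, map_mul, hp, aeval_X]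
  have hvh : ∀ p, aeval h p = v.hom p := fun p => by
    induction p using MvPolynomial.induction_on with
    | C s => rw [hvC]; simp
    | add p q hp hq => simp only [map_add, hp, hq]
    | mul_X p j hp => rw [map_mul, map_mul, hp, aeval_X]
  obtain ⟨N, hN, hN'⟩ := exists_linearPart_inverse f h (fun i => (hvh _).trans (hvu _))
    (fun j => (huf _).trans (huv _))
  refine ⟨linearPart f, isIso_linearMorphism hN hN', fun g => ?_⟩
  have key : ∀ g i k, ∑ j, β g (linearPart f i j) * algebraMap K S ((ρ g⁻¹).val j k) =
      ∑ l, algebraMap K S ((ρ' g⁻¹).val i l) * linearPart f l k := by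
    intro g i k
    have := congrArg (fun p => constantCoeff (pderiv k p)) (huG g (X i))
    rw [constantCoeff_pderiv_productAction, productAction_apply, productActionHom_X] at this
    refine this.trans ?_
    simp [huC, linearPart, f]
  exact linearMorphism_equivariant β (key g⁻¹)

end Linear

/-! ### The isomorphism over the free locus -/

section FreeLocus

open scoped TensorProduct

variable {K S : Type u} {G : Type v} [Field K] [CommRing S] [Algebra K S] [Group G] [Finite G]
  {m : ℕ} (β : G →* (S ≃ₐ[K] S)) (ρ : G →* Matrix.GeneralLinearGroup (Fin m) K)

/-- Otherwise `g` fixes `x` and acts trivially on its residue field. Then `(g⁻¹, x)` and `(1, x)`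
have the same image as residue-field-valued points, contradicting that a closed embedding is a
monomorphism. -/
lemma IsFreeOn.exists_sub_notMem {β : G →* (S ≃ₐ[K] S)} {V : (Spec (.of S)).Opens}
    (hV : IsFreeOn β V) {x : PrimeSpectrum S} (hx : x ∈ V) {g : G} (hg : g ≠ 1) :
    ∃ y, y - β g y ∉ x.asIdeal := by
  obtain ⟨hV, hfree⟩ := hV
  by_contra! h
  let χ : S →+* x.asIdeal.ResidueField := algebraMap S _
  let pt : Spec (.of x.asIdeal.ResidueField) ⟶ Spec (.of S) := Spec.map (CommRingCat.ofHom χ)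
  have hpt : Set.range pt ⊆ Set.range V.ι := by
    rintro _ ⟨z, rfl⟩
    have : pt z = x := by
      refine PrimeSpectrum.ext ?_
      change Ideal.comap χ z.asIdeal = _
      have hz : z.asIdeal = ⊥ := by
        have : z.asIdeal.IsPrime := PrimeSpectrum.isPrime z
        exact (Ideal.eq_bot_of_prime z.asIdeal)
      rw [hz, ← RingHom.ker_eq_comap_bot]
      exact Ideal.ker_algebraMap_residueField x.asIdeal
    rw [this, Scheme.Opens.range_ι]
    exact hx
  let j : Spec (.of x.asIdeal.ResidueField) ⟶ V := IsOpenImmersion.lift V.ι pt hpt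
  have hj : j ≫ V.ι = pt := IsOpenImmersion.lift_fac _ _ _
  have hpt' : pt ≫ specAct β g⁻¹ = pt ≫ specAct β 1 := by
    simp only [pt, specAct, ← Spec.map_comp, ← CommRingCat.ofHom_comp]
    refine congrArg (fun f => Spec.map (CommRingCat.ofHom f)) (RingHom.ext fun y => ?_)
    have := h y
    rw [← Ideal.ker_algebraMap_residueField x.asIdeal, RingHom.mem_ker, map_sub, sub_eq_zero] at this
    simpa using this.symm
  have hsq : CommSq j j (Sigma.ι (fun _ : G => (V : Scheme.{u})) g⁻¹)
      (Sigma.ι (fun _ : G => (V : Scheme.{u})) 1) := by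
    refine ⟨?_⟩
    rw [← cancel_mono (actionGraph β V hV)]
    simp only [Category.assoc, actionGraph, Sigma.ι_desc]
    apply pullback.hom_ext
    · simp only [Category.assoc, pullback.lift_fst]
      rw [← cancel_mono V.ι]
      simp only [Category.assoc, Scheme.Hom.resLE_comp_ι]
      rw [← Category.assoc, ← Category.assoc, hj, hpt']
    · simp only [Category.assoc, pullback.lift_snd]
  -- The copies of `V` with indices `g⁻¹` and `1` are disjoint, so no point can factor through both.
  have := isEmpty_of_commSq_sigmaι_of_ne (g := fun _ : G => (V : Scheme.{u})) hsq (inv_ne_one.mpr hg)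
  exact this.false (show PrimeSpectrum x.asIdeal.ResidueField from ⊥)

lemma exists_isGaloisDenominator_notMem {x : PrimeSpectrum S} (hx : x ∈ freeLocus β) :
    ∃ d, IsGaloisDenominator β d ∧ d ∉ x.asIdeal := by
  classical
  cases nonempty_fintype G
  obtain ⟨V, hV, hxV⟩ := TopologicalSpace.Opens.mem_sSup.mp hx
  have : ∀ g : G, ∃ y, g ≠ 1 → y - β g y ∉ x.asIdeal := by
    intro g
    by_cases hg : g = 1
    · exact ⟨0, fun h => absurd hg h⟩
    · obtain ⟨y, hy⟩ := IsFreeOn.exists_sub_notMem hV hxV hg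
      exact ⟨y, fun _ => hy⟩
  choose y hy using this
  refine ⟨_, isGaloisDenominator_prod β y, fun hmem => ?_⟩
  obtain ⟨g, hg, hg'⟩ := (x.isPrime.prod_mem_iff).mp hmem
  exact hy g (Finset.ne_of_mem_erase hg) hg'

/-- A localization is bijective when the localized element annihilates kernel and cokernel. -/
lemma bijective_awayMap {A B : Type*} [CommRing A] [CommRing B] (φ : A →+* B) (r : A)
    (hker : ∀ a, φ a = 0 → r * a = 0) (hsurj : ∀ b, ∃ a, φ a = φ r * b) :
    Function.Bijective (Localization.awayMap φ r) := by
  constructor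
  · rw [injective_iff_map_eq_zero]
    intro z hz
    obtain ⟨a, ⟨_, n, rfl⟩, rfl⟩ := IsLocalization.exists_mk'_eq (Submonoid.powers r) z
    rw [Localization.awayMap, IsLocalization.Away.map, IsLocalization.map_mk',
      IsLocalization.mk'_eq_zero_iff] at hz
    obtain ⟨⟨_, k, rfl⟩, hk⟩ := hz
    rw [IsLocalization.mk'_eq_zero_iff]
    -- The power `r ^ k` moves `a` into the kernel; one more factor `r` annihilates it.
    refine ⟨⟨r ^ (k + 1), k + 1, rfl⟩, ?_⟩
    have := hker (r ^ k * a) (by simpa using hk)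
    rw [← this]
    simp [pow_succ]
    ring
  · intro z
    obtain ⟨b, ⟨_, n, rfl⟩, rfl⟩ := IsLocalization.exists_mk'_eq (Submonoid.powers (φ r)) z
    obtain ⟨a, ha⟩ := hsurj b
    refine ⟨IsLocalization.mk' _ a (⟨r ^ (n + 1), n + 1, rfl⟩ : Submonoid.powers r), ?_⟩
    rw [Localization.awayMap, IsLocalization.Away.map, IsLocalization.map_mk']
    rw [IsLocalization.mk'_eq_iff_eq]
    congr 1
    simp [ha, pow_succ]
    ring

lemma isIso_morphismRestrict_of_le {X Y : Scheme.{u}} (f : X ⟶ Y) {U W : Y.Opens} (h : U ≤ W)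
    [IsIso (f ∣_ W)] : IsIso (f ∣_ U) := by
  have e : W.ι ''ᵁ (W.ι ⁻¹ᵁ U) = U := by
    rw [Scheme.Hom.image_preimage_eq_opensRange_inf, Scheme.Opens.opensRange_ι, inf_eq_right.mpr h]
  have := ((MorphismProperty.isomorphisms Scheme).arrow_mk_iso_iff
    (morphismRestrictRestrict f W (W.ι ⁻¹ᵁ U) ≪≫ morphismRestrictEq f e)).mp
    (MorphismProperty.isomorphisms.infer_property _)
  exact this

lemma isIso_morphismRestrict_of_cover {X Y : Scheme.{u}} (f : X ⟶ Y) {U : Y.Opens}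
    (h : ∀ x ∈ U, ∃ W : Y.Opens, x ∈ W ∧ IsIso (f ∣_ W)) : IsIso (f ∣_ U) := by
  refine IsZariskiLocalAtTarget.of_forall_exists_morphismRestrict
    (P := MorphismProperty.isomorphisms Scheme) fun x => ?_
  obtain ⟨W, hxW, hW⟩ := h x.1 x.2
  refine ⟨U.ι ⁻¹ᵁ W, hxW, ?_⟩
  have e : U.ι ''ᵁ (U.ι ⁻¹ᵁ W) ≤ W :=
    Scheme.Hom.image_preimage_le _ _
  have := isIso_morphismRestrict_of_le f e
  exact ((MorphismProperty.isomorphisms Scheme).arrow_mk_iso_iff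
    (morphismRestrictRestrict f U (U.ι ⁻¹ᵁ W))).mpr this

/-- The basic open subset of an element of a ring. -/
def specBasicOpen {A : Type u} [CommRing A] (d : A) : (Spec (.of A)).Opens :=
  PrimeSpectrum.basicOpen d

/-- By the section `L`, `d ⊗ 1` annihilates the kernel and the cokernel of `μ`, so inverting it
makes `μ` bijective. -/
lemma isIso_toPullback_restrict_basicOpen {d : S} (hd : IsGaloisDenominator β d) :
    IsIso (toPullback β ρ ∣_ (pullback.fst (quotientMap β) (ZrhoToX β ρ) ⁻¹ᵁ
      specBasicOpen d)) := by
  obtain ⟨L, hL, hL'⟩ :=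
    hd.exists_section β (productAction β ρ) (productAction_algebraMap β ρ)
  have h : IsIso (Spec.map (CommRingCat.ofHom (mulMap β ρ)) ∣_
      specBasicOpen (d ⊗ₜ[invariants β] (1 : invariants (productAction β ρ)))) := by
    refine ((MorphismProperty.isomorphisms Scheme).arrow_mk_iso_iff
      (SpecMapRestrictBasicOpenIso (CommRingCat.ofHom (mulMap β ρ)) _)).mpr ?_
    rw [MorphismProperty.isomorphisms.iff, isIso_SpecMap_iff]
    have hmul : ∀ a, d ⊗ₜ[invariants β] (1 : invariants (productAction β ρ)) * a = d • a := fun a => by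
      induction a using TensorProduct.induction_on with
      | zero => simp
      | add a₁ a₂ h₁ h₂ => rw [mul_add, smul_add, h₁, h₂]
      | tmul s t => simp [TensorProduct.smul_tmul']
    refine bijective_awayMap (mulMap β ρ) _ (fun a ha => ?_) (fun b => ⟨L b, ?_⟩)
    · rw [hmul, ← hL]
      exact (congrArg L ha).trans (map_zero L)
    · refine (hL' b).trans ?_
      simp [Algebra.smul_def]
  rw [toPullback_eq, morphismRestrict_comp]
  have h₁ : IsIso (Spec.map (CommRingCat.ofHom (mulMap β ρ)) ∣_ (pullbackIso β ρ).inv ⁻¹ᵁ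
      (pullback.fst (quotientMap β) (ZrhoToX β ρ) ⁻¹ᵁ
      specBasicOpen d)) := by
    have e : (pullbackIso β ρ).inv ⁻¹ᵁ (pullback.fst (quotientMap β) (ZrhoToX β ρ) ⁻¹ᵁ
        specBasicOpen d) =
        specBasicOpen (d ⊗ₜ[invariants β] (1 : invariants (productAction β ρ))) := by
      rw [← Scheme.Hom.comp_preimage, pullbackIso_inv_fst]
      rfl
    rw [e]
    exact h
  have h₂ : IsIso ((pullbackIso β ρ).inv ∣_ (pullback.fst (quotientMap β) (ZrhoToX β ρ) ⁻¹ᵁ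
      specBasicOpen d)) := inferInstance
  exact IsIso.comp_isIso' h₁ h₂

theorem isIso_toPullback_restrict_freeLocus :
    IsIso (toPullback β ρ ∣_
      (pullback.fst (quotientMap β) (ZrhoToX β ρ) ⁻¹ᵁ freeLocus β)) := by
  refine isIso_morphismRestrict_of_cover _ fun x hx => ?_
  obtain ⟨d, hd, hdx⟩ := exists_isGaloisDenominator_notMem β hx
  exact ⟨_, hdx, isIso_toPullback_restrict_basicOpen β ρ hd⟩

end FreeLocus

end PullbackNormalization

theorem mainTheorem1 {K S : Type u} {G : Type v} [Field K] [CommRing S] [Algebra K S]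
    [IsDomain S] [IsIntegrallyClosed S] [Group G] [Finite G]
    (β : G →* (S ≃ₐ[K] S)) (hβ : Function.Injective β)
    {m : ℕ} (ρ : G →* Matrix.GeneralLinearGroup (Fin m) K) :
    -- the natural morphism is equivariant, finite and surjective
    (∀ g : G, specAct (productAction β ρ) g ≫
          toPullback β ρ =
        toPullback β ρ ≫ pullbackAct β ρ g) ∧
    IsFinite (toPullback β ρ) ∧
    Surjective (toPullback β ρ) ∧
    -- it is the normalization
    IsNormalization (toPullback β ρ) ∧
    -- it is an isomorphism over the free locus
    IsIso (toPullback β ρ ∣_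
      (pullback.fst (quotientMap β) (ZrhoToX β ρ) ⁻¹ᵁ
        freeLocus β)) ∧
    -- the action on the bundle is the only lift of the action on the pull-back
    (∀ (g : G) (ψ : bundle S m ⟶ bundle S m),
      ψ ≫ toPullback β ρ =
          toPullback β ρ ≫ pullbackAct β ρ g →
        ψ = specAct (productAction β ρ) g) ∧
    -- an isomorphism of the quotient schemes over `X` lifts uniquely to the bundles, the lift is
    -- an equivariant isomorphism, and the two linear actions are linearly equivalent over `Y`
    (∀ {m' : ℕ} (ρ' : G →* Matrix.GeneralLinearGroup (Fin m') K)
      (θ : Zrho β ρ ≅ Zrho β ρ')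
      (hθ : θ.hom ≫ ZrhoToX β ρ' = ZrhoToX β ρ),
      (∃ Θ : bundle S m ⟶ bundle S m',
        IsIso Θ ∧
        Θ ≫ toPullback β ρ' =
          toPullback β ρ ≫
            pullbackMap β ρ ρ' θ.hom hθ ∧
        (∀ Θ' : bundle S m ⟶ bundle S m',
          Θ' ≫ toPullback β ρ' =
            toPullback β ρ ≫
              pullbackMap β ρ ρ' θ.hom hθ → Θ' = Θ) ∧
        ∀ g : G, specAct (productAction β ρ) g ≫ Θ =
          Θ ≫ specAct (productAction β ρ') g) ∧
      ∃ M : Matrix (Fin m') (Fin m) S,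
        IsIso (linearMorphism M) ∧
        ∀ g : G, specAct (productAction β ρ) g ≫
            linearMorphism M =
          linearMorphism M ≫
            specAct (productAction β ρ') g) := by
  refine ⟨toPullback_equivariant β ρ, isFinite_toPullback β ρ, surjective_toPullback β ρ,
    isNormalization_toPullback β ρ hβ, isIso_toPullback_restrict_freeLocus β ρ,
    eq_specAct_of_comp_toPullback β ρ hβ, fun {m'} ρ' θ hθ => ?_⟩
  obtain ⟨Θ, hΘ⟩ := exists_lift β hβ θ hθ
  have hproj := comp_bundleProj_of_lift β hΘ
  have hequiv := equivariant_of_lift β hβ hΘ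
  refine ⟨⟨Θ.hom, inferInstance, hΘ, fun Θ' hΘ' => ?_, hequiv⟩,
    exists_linear_equivariant β Θ hproj hequiv⟩
  refine (bundle_hom_ext β ρ' hβ (hΘ.trans hΘ'.symm) (RingHom.id S) Function.injective_id ?_).symm
  rw [hproj, CommRingCat.ofHom_id, Spec.map_id, Category.comp_id]
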